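/- Let $\mathcal X,\mathcal Y$ be finite sets and, for each $n\ge 1$, let $(X^n,Y^n)$ be a pair of random vectors with an arbitrary joint distribution $P_{X^nY^n}$ on $\mathcal X^n\times\mathcal Y^n$ (no consistency between different $n$ is assumed). Let $d$ denote Hamming distance. Assume that the source $(\mathbf X,\mathbf Y)=\{(X^n,Y^n)\}_{n\ge1}$ is \emph{smooth}: there is a constant $0<q<1$, not depending on $n$, such that $P_{X^nY^n}(\mathbf x,\hat{\mathbf y})\ge q\,P_{X^nY^n}(\mathbf x,\mathbf y)$ whenever $d(\mathbf y,\hat{\mathbf y})=1$, and $P_{X^nY^n}(\hat{\mathbf x},\mathbf y)\ge q\,P_{X^nY^n}(\mathbf x,\mathbf y)$ whenever $d(\mathbf x,\hat{\mathbf x})=1$. Let $f_n\colon\mathcal X^n\times\mathcal Y^n\to\mathcal Z_n$ $(n\ge1)$ be functions such that every $f_n$ is \emph{totally sensitive}, that is: (i) $f_n(\mathbf x,\mathbf y)\ne f_n(\hat{\mathbf x},\hat{\mathbf y})$ whenever $\mathbf x\neq\hat{\mathbf x}$ and $\mathbf y\ne\hat{\mathbf y}$; (ii) if $f_n(\mathbf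 x,\mathbf y)=f_n(\hat{\mathbf x},\mathbf y)$ and $x_i\ne\hat x_i$ for some $i$, then there is $\hat{\mathbf y}\in\mathcal Y^n$ that differs from $\mathbf y$ exactly in position $i$ and satisfies $f_n(\mathbf x,\hat{\mathbf y})\neq f_n(\hat{\mathbf x},\hat{\mathbf y})$; (iii) the same as (ii) with the roles of $\mathbf x$ and $\mathbf y$ exchanged. A \emph{variable-length code} for a function $g_n$ on $\mathcal X^n\times\mathcal Y^n$ with values in a set $\mathcal W_n$ is a triple $\Phi_n=(\varphi^{(1)}_n,\varphi^{(2)}_n,\psi_n)$ of encoders $\varphi^{(1)}_n\colon\mathcal X^n\to\{0,1\}^*$ and $\varphi^{(2)}_n\colon\mathcal Y^n\to\{0,1\}^*$, whose images $\mathcal C^{(1)}_n,\mathcal C^{(2)}_n$ both satisfy the prefix condition (no codeword is a proper prefix of another), and a decoder $\psi_n\colon\mathcal C^{(1)}_n\times\mathcal C^{(2)}_n\to\mathcal W_n$. It is a \emph{fixed-length code} if, for each $i=1,2$, all elements of $\mathcal C^{(i)}_n$ have the same length. Its error probability is $\mathrm P_{\mathrm e}(\Phi_n|g_n)=\Pr\{g_n(X^n,Y^n)\ne\psi_n(\varphi^{(1)}_n(X^n),\varphi^{(2)}_n(Y^n))\}$,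 and $|\cdot|$ denotes the length of a string. A \emph{Slepian–Wolf code} is a code for the identity function $f^{\mathrm{id}}_n(\mathbf x,\mathbf y)=(\mathbf x,\mathbf y)$. Then for all real $R_1,R_2$ and every sequence $\{\Phi_n\}_{n\ge1}$ of variable-length (resp. fixed-length) codes for $f_n$ satisfying $$\lim_{n\to\infty}\mathrm P_{\mathrm e}(\Phi_n|f_n)=0,\qquad \limsup_{n\to\infty}\tfrac1n\mathbb E\bigl[|\varphi^{(1)}_n(X^n)|\bigr]\le R_1,\qquad \limsup_{n\to\infty}\tfrac1n\mathbb E\bigl[|\varphi^{(2)}_n(Y^n)|\bigr]\le R_2,$$ there exists a sequence $\{\hat\Phi_n\}_{n\ge1}$, $\hat\Phi_n=(\hat\varphi^{(1)}_n,\hat\varphi^{(2)}_n,\hat\psi_n)$, of variable-length (resp. fixed-length) Slepian–Wolf codes such that $$\lim_{n\to\infty}\mathrm P_{\mathrm e}(\hat\Phi_n|f^{\mathrm{id}}_n)=0,\qquad \limsup_{n\to\infty}\tfrac1n\mathbb E\bigl[|\hat\varphi^{(1)}_n(X^n)|\bigr]\le R_1,\qquad \limsup_{n\to\infty}\tfrac1n\mathbb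 E\bigl[|\hat\varphi^{(2)}_n(Y^n)|\bigr]\le R_2.$$ -/

import Mathlib

open Filter Topology

noncomputable section

namespace FunctionCoding

/-- A general correlated source with alphabets `X` and `Y`: for every block length `n`, an arbitrary
joint distribution of `(Xⁿ, Yⁿ)`, with no consistency between different block lengths. -/
abbrev Source (X Y : Type*) : Type _ :=
  ∀ n : ℕ, PMF ((Fin n → X) × (Fin n → Y))

/-- The prefix condition: no codeword is a proper prefix of another codeword. -/
def PrefixCondition (C : Set (List Bool)) : Prop :=
  ∀ c ∈ C, ∀ c' ∈ C, c <+: c' → c = c'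

/-- A variable-length code: two separate encoders into binary strings whose sets of codewords satisfy
the prefix condition, and a joint decoder defined on pairs of codewords. -/
structure Code (A B Z : Type*) where
  /-- The first encoder. -/
  enc₁ : A → List Bool
  /-- The second encoder. -/
  enc₂ : B → List Bool
  /-- The decoder. -/
  dec : Set.range enc₁ → Set.range enc₂ → Z
  prefix₁ : PrefixCondition (Set.range enc₁)
  prefix₂ : PrefixCondition (Set.range enc₂)

namespace Code

variable {A B Z : Type*}

/-- The output of the decoder when the two terminals observe `a` and `b`. -/
def output (Φ : Code A B Z) (a : A) (b : B) : Z :=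
  Φ.dec ⟨Φ.enc₁ a, Set.mem_range_self a⟩ ⟨Φ.enc₂ b, Set.mem_range_self b⟩

/-- For each of the two encoders, all codewords have the same length. -/
def IsFixedLength (Φ : Code A B Z) : Prop :=
  (∀ a a' : A, (Φ.enc₁ a).length = (Φ.enc₁ a').length) ∧
    ∀ b b' : B, (Φ.enc₂ b).length = (Φ.enc₂ b').length

/-- Average codeword length of the first encoder; `∑ b, P (a, b)` is the marginal of `a`. -/
def avgLength₁ [Fintype A] [Fintype B] (Φ : Code A B Z) (P : PMF (A × B)) : ℝ :=
  ∑ a : A, (∑ b : B, (P (a, b)).toReal) * ((Φ.enc₁ a).length : ℝ)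

/-- Average codeword length of the second encoder. -/
def avgLength₂ [Fintype A] [Fintype B] (Φ : Code A B Z) (P : PMF (A × B)) : ℝ :=
  ∑ b : B, (∑ a : A, (P (a, b)).toReal) * ((Φ.enc₂ b).length : ℝ)

open Classical in
/-- The probability that the output of the decoder differs from `f`. -/
def errorProb [Fintype A] [Fintype B] (Φ : Code A B Z) (P : PMF (A × B)) (f : A → B → Z) : ℝ :=
  ∑ a : A, ∑ b : B, if f a b ≠ Φ.output a b then (P (a, b)).toReal else 0

end Code

/-- `f` on `Xⁿ × Yⁿ` is sensitive conditioned on `Yⁿ`. -/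
def SensitiveGivenSnd {X Y Z : Type*} {n : ℕ} (f : (Fin n → X) → (Fin n → Y) → Z) : Prop :=
  ∀ (x x' : Fin n → X) (y : Fin n → Y) (i : Fin n), f x y = f x' y → x i ≠ x' i →
    ∃ y' : Fin n → Y, y' i ≠ y i ∧ (∀ j, j ≠ i → y' j = y j) ∧ f x y' ≠ f x' y'

/-- `f` on `Xⁿ × Yⁿ` is sensitive conditioned on `Xⁿ`. -/
def SensitiveGivenFst {X Y Z : Type*} {n : ℕ} (f : (Fin n → X) → (Fin n → Y) → Z) : Prop :=
  ∀ (x : Fin n → X) (y y' : Fin n → Y) (i : Fin n), f x y = f x y' → y i ≠ y' i →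
    ∃ x' : Fin n → X, x' i ≠ x i ∧ (∀ j, j ≠ i → x' j = x j) ∧ f x' y ≠ f x' y'

/-- Joint sensitivity. -/
def JointlySensitive {X Y Z : Type*} {n : ℕ} (f : (Fin n → X) → (Fin n → Y) → Z) : Prop :=
  ∀ (x x' : Fin n → X) (y y' : Fin n → Y), x ≠ x' → y ≠ y' → f x y ≠ f x' y'

/-- Total sensitivity of a single function. -/
def TotallySensitive {X Y Z : Type*} {n : ℕ} (f : (Fin n → X) → (Fin n → Y) → Z) : Prop :=
  JointlySensitive f ∧ SensitiveGivenFst f ∧ SensitiveGivenSnd f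

/-- The source is smooth with respect to its second component. -/
def SmoothSnd {X Y : Type*} [DecidableEq Y] (P : Source X Y) : Prop :=
  ∃ q : ℝ, 0 < q ∧ q < 1 ∧ ∀ n : ℕ, 1 ≤ n → ∀ (x : Fin n → X) (y y' : Fin n → Y),
    hammingDist y y' = 1 → q * (P n (x, y)).toReal ≤ (P n (x, y')).toReal

/-- The source is smooth with respect to its first component. -/
def SmoothFst {X Y : Type*} [DecidableEq X] (P : Source X Y) : Prop :=
  ∃ q : ℝ, 0 < q ∧ q < 1 ∧ ∀ n : ℕ, 1 ≤ n → ∀ (x x' : Fin n → X) (y : Fin n → Y),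
    hammingDist x x' = 1 → q * (P n (x, y)).toReal ≤ (P n (x', y)).toReal

/-- A smooth source. -/
def Smooth {X Y : Type*} [DecidableEq X] [DecidableEq Y] (P : Source X Y) : Prop :=
  SmoothFst P ∧ SmoothSnd P

/-- The identity functions, whose codes are the Slepian–Wolf codes. -/
def idFun (X Y : Type*) (n : ℕ) (x : Fin n → X) (y : Fin n → Y) : (Fin n → X) × (Fin n → Y) :=
  (x, y)

/-- The sequence of codes `Φ` computes `f` with vanishing error probability at asymptotic average
rates at most `(R₁, R₂)`. The upper limits are taken in the extended reals. -/
def Achieves {X Y : Type*} [Fintype X] [Fintype Y] {Z : ℕ → Type*} (P : Source X Y)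
    (f : ∀ n, (Fin n → X) → (Fin n → Y) → Z n)
    (Φ : ∀ n, Code (Fin n → X) (Fin n → Y) (Z n)) (R₁ R₂ : ℝ) : Prop :=
  Tendsto (fun n => (Φ n).errorProb (P n) (f n)) atTop (𝓝 0) ∧
    limsup (fun n : ℕ => (((1 / (n : ℝ)) * (Φ n).avgLength₁ (P n) : ℝ) : EReal)) atTop
      ≤ (R₁ : EReal) ∧
    limsup (fun n : ℕ => (((1 / (n : ℝ)) * (Φ n).avgLength₂ (P n) : ℝ) : EReal)) atTop
      ≤ (R₂ : EReal)

end FunctionCoding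

end

/-! A code for `f` becomes a Slepian–Wolf code once o(n) label bits are appended to each codeword.
Call `(x, y)` good if `f` is decoded correctly there and few single-letter substitutions, counted by
position, lead from it to a decoding error. If two good pairs share both codewords, they share the
decoder output, hence the value of `f`, so joint sensitivity makes them agree in one component, say
`y`. At each `i` with `x i ≠ x' i`, conditional sensitivity changes `y i` so that the two values of
`f` split while the decoder output stays common: one of the pairs is exposed at `i`. So `x` and `x'`
are at distance at most `ρ n` (`hammingDist_le_card_exposed`), and a colouring of words that
separates such neighbours tells them apart (`exists_bits_separating`).

By smoothness, a substitution costs at most a factor `q` of probability, so double counting bounds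
the mass of heavily exposed pairs by O(ε / ρ), where ε is the original error (`sum_exposed_le`).
Taking ρ → 0 with ε / ρ → 0 makes the new error vanish, while Hamming balls of radius `ρ n` have
size exp(o(n)), so the labels cost no rate. -/

namespace FunctionCoding

/-! ### Colouring and volume of Hamming balls -/

/-- Greedy colouring: a symmetric relation all of whose neighbourhoods, each completed by its
centre, have at most `N` elements admits a proper colouring with `N` colours. -/
theorem exists_coloring_of_card_le {A : Type*} [Fintype A] [DecidableEq A] (r : A → A → Prop)
    [DecidableRel r] (hrefl : ∀ a, r a a) (hsymm : ∀ a b, r a b → r b a) (N : ℕ)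
    (hN : ∀ a, (Finset.univ.filter (r a)).card ≤ N) :
    ∃ c : A → Fin N, ∀ a b, r a b → c a = c b → a = b := by
  classical
  rcases isEmpty_or_nonempty A with hA | ⟨⟨a₀⟩⟩
  · exact ⟨fun a => hA.elim a, fun a => hA.elim a⟩
  have hpos : 0 < N :=
    lt_of_lt_of_le (Finset.card_pos.2 ⟨a₀, by simp [hrefl]⟩) (hN a₀)
  suffices h : ∀ s : Finset A, ∃ c : A → Fin N, ∀ a ∈ s, ∀ b ∈ s, r a b → c a = c b → a = b by
    obtain ⟨c, hc⟩ := h Finset.univ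
    exact ⟨c, fun a b => hc a (Finset.mem_univ _) b (Finset.mem_univ _)⟩
  intro s
  induction s using Finset.induction_on with
  | empty => exact ⟨fun _ => ⟨0, hpos⟩, by simp⟩
  | insert a s ha ih =>
    obtain ⟨c, hc⟩ := ih
    have hcard : (((Finset.univ.filter (r a)).erase a).image c).card < Fintype.card (Fin N) := by
      rw [Fintype.card_fin]
      refine lt_of_le_of_lt Finset.card_image_le (lt_of_lt_of_le ?_ (hN a))
      exact Finset.card_erase_lt_of_mem (by simp [hrefl])
    obtain ⟨k, hk⟩ : ∃ k, k ∉ ((Finset.univ.filter (r a)).erase a).image c := by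
      by_contra! h
      rw [Finset.eq_univ_iff_forall.2 h, Finset.card_univ] at hcard
      exact lt_irrefl _ hcard
    have hk' : ∀ b, b ≠ a → r a b → c b ≠ k := fun b hb hr he =>
      hk (Finset.mem_image.2 ⟨b, by simp [hb, hr], he⟩)
    refine ⟨Function.update c a k, fun u hu v hv huv he => ?_⟩
    by_cases hua : u = a <;> by_cases hva : v = a
    · rw [hua, hva]
    · subst hua
      rw [Function.update_self, Function.update_of_ne hva] at he
      exact absurd he.symm (hk' v hva huv)
    · subst hva
      rw [Function.update_self, Function.update_of_ne hua] at he
      exact absurd he (hk' u hua (hsymm _ _ huv))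
    · rw [Function.update_of_ne hua, Function.update_of_ne hva] at he
      exact hc u (Finset.mem_of_mem_insert_of_ne hu hua) v
        (Finset.mem_of_mem_insert_of_ne hv hva) huv he

/-- The enumerator of Hamming distances from a fixed word. -/
theorem sum_pow_hammingDist {X : Type*} [Fintype X] [DecidableEq X] {n : ℕ} (x : Fin n → X)
    (t : ℝ) :
    ∑ x' : Fin n → X, t ^ hammingDist x x' = (1 + ((Fintype.card X : ℝ) - 1) * t) ^ n := by
  have h1 : ∀ x' : Fin n → X,
      t ^ hammingDist x x' = ∏ i, (if x i = x' i then 1 else t) := fun x' => by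
    rw [Finset.prod_ite]
    simp [hammingDist]
  have h2 : ∀ i, ∑ c : X, (if x i = c then 1 else t) = 1 + ((Fintype.card X : ℝ) - 1) * t := by
    intro i
    have : ∀ c : X, (if x i = c then 1 else t) = t + if x i = c then 1 - t else 0 := by
      intro c; split_ifs <;> ring
    simp_rw [this, Finset.sum_add_distrib]
    simp
    ring
  simp_rw [h1]
  rw [← Fintype.piFinset_univ, ← Finset.prod_univ_sum (fun _ => Finset.univ)
    (fun i c => if x i = c then (1 : ℝ) else t)]
  simp [h2]

/-- Volume bound for Hamming balls of relative radius `ρ`. -/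
theorem card_hammingBall_le {X : Type*} [Fintype X] [DecidableEq X] {n : ℕ} (x : Fin n → X)
    {ρ : ℝ} (h0 : 0 < ρ) (h1 : ρ ≤ 1) :
    ((Finset.univ.filter fun x' => (hammingDist x x' : ℝ) ≤ ρ * n).card : ℝ) ≤
      Real.exp (n * (Real.negMulLog ρ + Fintype.card X * ρ)) := by
  -- Chernoff bound with parameter `ρ` itself: inside the ball each weight is at least `ρ ^ (ρ n)`.
  have hlow : ((Finset.univ.filter fun x' => (hammingDist x x' : ℝ) ≤ ρ * n).card : ℝ) *
      Real.exp (-(n * Real.negMulLog ρ)) ≤ ∑ x' : Fin n → X, ρ ^ hammingDist x x' := by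
    rw [← nsmul_eq_mul, ← Finset.sum_const]
    refine (Finset.sum_le_sum fun x' hx' => ?_).trans
      (Finset.sum_le_sum_of_subset_of_nonneg (Finset.filter_subset _ _)
        fun _ _ _ => by positivity)
    rw [Finset.mem_filter] at hx'
    rw [← Real.rpow_natCast, Real.rpow_def_of_pos h0, Real.exp_le_exp, Real.negMulLog]
    nlinarith [hx'.2, Real.log_nonpos h0.le h1]
  have hup : ∑ x' : Fin n → X, ρ ^ hammingDist x x' ≤ Real.exp (n * (Fintype.card X * ρ)) := by
    rw [sum_pow_hammingDist, Real.exp_nat_mul]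
    rcases Nat.eq_zero_or_pos n with rfl | hn
    · simp
    have : 1 ≤ (Fintype.card X : ℝ) := by
      exact_mod_cast Fintype.card_pos_iff.2 ⟨x ⟨0, hn⟩⟩
    refine pow_le_pow_left₀ (by nlinarith) ?_ n
    nlinarith [Real.add_one_le_exp ((Fintype.card X : ℝ) * ρ)]
  have h := hlow.trans hup
  rw [Real.exp_neg, ← div_eq_mul_inv, div_le_iff₀ (Real.exp_pos _), ← Real.exp_add] at h
  refine h.trans (le_of_eq ?_)
  ring_nf

/-! ### Smoothness and exposed positions -/

/-- Resampling one coordinate uniformly: summing over words and over replacement letters. -/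
theorem sum_sum_update {Y : Type*} [Fintype Y] {n : ℕ} (i : Fin n) (g : (Fin n → Y) → ℝ) :
    ∑ y : Fin n → Y, ∑ c : Y, g (Function.update y i c) = Fintype.card Y * ∑ y, g y := by
  -- Exchanging the new letter with the old one permutes the pairs (word, letter).
  have hinv : Function.Involutive
      (fun z : (Fin n → Y) × Y => (Function.update z.1 i z.2, z.1 i)) := fun z => by simp
  rw [← Fintype.sum_prod_type' (fun y c => g (Function.update y i c)),
    Fintype.sum_equiv hinv.toPerm (fun z : (Fin n → Y) × Y => g (Function.update z.1 i z.2))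
      (fun z => g z.1) (fun z => rfl), Fintype.sum_prod_type]
  simp [Finset.mul_sum]

open Classical in
/-- The positions of `y` at which some substitution turns `(a, y)` into a pair satisfying `E`. -/
noncomputable def exposed {A Y : Type*} {n : ℕ} (E : A → (Fin n → Y) → Prop) (a : A)
    (y : Fin n → Y) : Finset (Fin n) :=
  Finset.univ.filter fun i => ∃ c, E a (Function.update y i c)

theorem hammingDist_update_of_ne {Y : Type*} [DecidableEq Y] {n : ℕ} (y : Fin n → Y) (i : Fin n)
    {c : Y} (hc : c ≠ y i) : hammingDist y (Function.update y i c) = 1 := by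
  rw [hammingDist, Finset.card_eq_one]
  refine ⟨i, ?_⟩
  ext j
  by_cases hj : j = i
  · subst hj; simpa using hc.symm
  · simp [hj]

open Classical in
/-- Under smoothness, a rare event `E` exposes few positions of a typical word. -/
theorem sum_exposed_le {A Y : Type*} [Fintype A] [Fintype Y] [DecidableEq Y] {n : ℕ}
    (p : A → (Fin n → Y) → ℝ) (hp : ∀ a y, 0 ≤ p a y) {q : ℝ} (hq : 0 < q) (hq1 : q < 1)
    (hsm : ∀ a y y', hammingDist y y' = 1 → q * p a y ≤ p a y')
    (E : A → (Fin n → Y) → Prop) {δ : ℝ} (hδ : 0 < δ) (hn : 1 ≤ n) :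
    (∑ a, ∑ y, if δ * n < (exposed E a y).card then p a y else 0) ≤
      Fintype.card Y / (q * δ) * ∑ a, ∑ y, if E a y then p a y else 0 := by
  have hn' : (0 : ℝ) < n := by exact_mod_cast hn
  have hup : ∀ a y i c, q * p a y ≤ p a (Function.update y i c) := by
    intro a y i c
    by_cases hc : c = y i
    · subst hc
      rw [Function.update_eq_self]
      nlinarith [hp a y]
    · exact hsm _ _ _ (hammingDist_update_of_ne y i hc)
  set g : A → (Fin n → Y) → ℝ := fun a y => if E a y then p a y else 0 with hg
  have hg0 : ∀ a y, 0 ≤ g a y := fun a y => by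
    simp only [hg]; split_ifs; exacts [hp a y, le_rfl]
  -- Each exposed position supplies a substitution landing in `E`, with mass at least `q * p a y`.
  have hcount : ∀ a y, q * (p a y * (exposed E a y).card) ≤
      ∑ i, ∑ c, g a (Function.update y i c) := by
    intro a y
    have : q * (p a y * (exposed E a y).card) = ∑ i ∈ exposed E a y, q * p a y := by
      rw [Finset.sum_const, nsmul_eq_mul]; ring
    rw [this]
    refine (Finset.sum_le_sum fun i hi => ?_).trans
      (Finset.sum_le_sum_of_subset_of_nonneg (Finset.subset_univ _)
        fun i _ _ => Finset.sum_nonneg fun c _ => hg0 _ _)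
    obtain ⟨c, hc⟩ : ∃ c, E a (Function.update y i c) := by simpa [exposed] using hi
    calc q * p a y ≤ p a (Function.update y i c) := hup a y i c
      _ = g a (Function.update y i c) := by simp [hg, hc]
      _ ≤ _ := Finset.single_le_sum (f := fun c => g a (Function.update y i c))
        (fun c _ => hg0 _ _) (Finset.mem_univ c)
  have htot : ∀ a, ∑ y, ∑ i, ∑ c, g a (Function.update y i c) =
      n * (Fintype.card Y * ∑ y, g a y) := by
    intro a
    rw [Finset.sum_comm]
    simp_rw [sum_sum_update]
    simp
  -- Markov's inequality, pointwise.
  have hmark : ∀ a y, q * δ * n * (if δ * n < (exposed E a y).card then p a y else 0) ≤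
      q * (p a y * (exposed E a y).card) := by
    intro a y
    split_ifs with h
    · have := mul_le_mul_of_nonneg_left h.le (mul_nonneg hq.le (hp a y))
      linarith
    · rw [mul_zero]
      exact mul_nonneg hq.le (mul_nonneg (hp a y) (Nat.cast_nonneg _))
  have key : q * δ * n * (∑ a, ∑ y, if δ * n < (exposed E a y).card then p a y else 0) ≤
      n * (Fintype.card Y * ∑ a, ∑ y, g a y) := by
    calc _ = ∑ a, ∑ y, q * δ * n * (if δ * n < (exposed E a y).card then p a y else 0) := by
          simp_rw [Finset.mul_sum]
      _ ≤ ∑ a, ∑ y, ∑ i, ∑ c, g a (Function.update y i c) :=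
          Finset.sum_le_sum fun a _ => Finset.sum_le_sum fun y _ =>
            (hmark a y).trans (hcount a y)
      _ = _ := by simp_rw [htot, ← Finset.mul_sum]
  rw [div_mul_eq_mul_div, le_div_iff₀ (by positivity)]
  refine le_of_mul_le_mul_left ?_ hn'
  linarith

/-! ### Label bits and the enlarged code -/

/-- Appending blocks of constant length to the codewords preserves the prefix condition. -/
theorem PrefixCondition.append {A : Type*} {e b : A → List Bool} {m : ℕ}
    (he : PrefixCondition (Set.range e)) (hb : ∀ a, (b a).length = m) :
    PrefixCondition (Set.range fun a => e a ++ b a) := by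
  rintro _ ⟨a, rfl⟩ _ ⟨a', rfl⟩ h
  have h1 : e a <+: e a' ++ b a' := (List.prefix_append _ _).trans h
  have heq : e a = e a' := by
    rcases List.prefix_or_prefix_of_prefix h1 (List.prefix_append _ _) with h2 | h2
    · exact he _ ⟨a, rfl⟩ _ ⟨a', rfl⟩ h2
    · exact (he _ ⟨a', rfl⟩ _ ⟨a, rfl⟩ h2).symm
  exact h.eq_of_length (by simp [heq, hb])

/-- Words can be labelled by `m` bits such that distinct words at relative distance at most `ρ` get
distinct labels, as soon as `2 ^ m` is at least the size of the Hamming balls. -/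
theorem exists_bits_separating {X : Type*} [Fintype X] [DecidableEq X] {n m : ℕ} {ρ : ℝ}
    (hρ : 0 ≤ ρ) (hm : ∀ x : Fin n → X,
      (Finset.univ.filter fun x' => (hammingDist x x' : ℝ) ≤ ρ * n).card ≤ 2 ^ m) :
    ∃ b : (Fin n → X) → List Bool, (∀ x, (b x).length = m) ∧
      ∀ x x', (hammingDist x x' : ℝ) ≤ ρ * n → b x = b x' → x = x' := by
  classical
  obtain ⟨c, hc⟩ := exists_coloring_of_card_le
    (fun x x' : Fin n → X => (hammingDist x x' : ℝ) ≤ ρ * n)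
    (fun x => by rw [hammingDist_self, Nat.cast_zero]; positivity)
    (fun x x' h => by rwa [hammingDist_comm]) (2 ^ m) (fun x => by convert hm x)
  let e : Fin (2 ^ m) ≃ (Fin m → Bool) :=
    Fintype.equivOfCardEq (by simp)
  refine ⟨fun x => List.ofFn (e (c x)), fun x => by simp, fun x x' h hb => hc x x' h ?_⟩
  exact e.injective (List.ofFn_injective hb)

theorem sum_toReal_eq_one {A B : Type*} [Fintype A] [Fintype B] (P : PMF (A × B)) :
    ∑ a : A, ∑ b : B, (P (a, b)).toReal = 1 := by
  rw [← Fintype.sum_prod_type' (fun a b => (P (a, b)).toReal), ← ENNReal.toReal_sum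
    (fun z _ => P.apply_ne_top z), ← tsum_fintype (L := SummationFilter.unconditional _),
    P.tsum_coe, ENNReal.toReal_one]

namespace Code

variable {A B Z : Type*}

/-- Append label blocks to the codewords, and decode to a pair in `T` with the given codewords. -/
noncomputable def withLabels [Nonempty (A × B)] (Φ : Code A B Z) {b₁ : A → List Bool}
    {b₂ : B → List Bool} {m₁ m₂ : ℕ} (h₁ : ∀ a, (b₁ a).length = m₁) (h₂ : ∀ b, (b₂ b).length = m₂)
    (T : A → B → Prop) : Code A B (A × B) where
  enc₁ a := Φ.enc₁ a ++ b₁ a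
  enc₂ b := Φ.enc₂ b ++ b₂ b
  dec c d := Classical.epsilon fun z : A × B =>
    T z.1 z.2 ∧ Φ.enc₁ z.1 ++ b₁ z.1 = c ∧ Φ.enc₂ z.2 ++ b₂ z.2 = d
  prefix₁ := Φ.prefix₁.append h₁
  prefix₂ := Φ.prefix₂.append h₂

variable [Nonempty (A × B)] (Φ : Code A B Z) {b₁ : A → List Bool}
    {b₂ : B → List Bool} {m₁ m₂ : ℕ} (h₁ : ∀ a, (b₁ a).length = m₁) (h₂ : ∀ b, (b₂ b).length = m₂)
    (T : A → B → Prop)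

/-- Constant label lengths let each received word be split into codeword and label; by `huniq` the
only pair in `T` compatible with them is the transmitted one, so `epsilon` must pick it. -/
theorem output_withLabels
    (huniq : ∀ a b a' b', T a b → T a' b' → Φ.enc₁ a = Φ.enc₁ a' → Φ.enc₂ b = Φ.enc₂ b' →
      b₁ a = b₁ a' → b₂ b = b₂ b' → a = a' ∧ b = b') {a : A} {b : B} (hT : T a b) :
    (Φ.withLabels h₁ h₂ T).output a b = (a, b) := by
  have hspec : T _ _ ∧ _ ∧ _ := Classical.epsilon_spec (p := fun z : A × B =>
    T z.1 z.2 ∧ Φ.enc₁ z.1 ++ b₁ z.1 = Φ.enc₁ a ++ b₁ a ∧ Φ.enc₂ z.2 ++ b₂ z.2 = Φ.enc₂ b ++ b₂ b)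
    ⟨(a, b), hT, rfl, rfl⟩
  change Classical.epsilon _ = _
  obtain ⟨hT', he₁, he₂⟩ := hspec
  have s₁ := List.append_inj' he₁ (by rw [h₁, h₁])
  have s₂ := List.append_inj' he₂ (by rw [h₂, h₂])
  have := huniq _ _ _ _ hT' hT s₁.1 s₂.1 s₁.2 s₂.2
  exact Prod.ext this.1 this.2

theorem isFixedLength_withLabels (h : Φ.IsFixedLength) : (Φ.withLabels h₁ h₂ T).IsFixedLength :=
  ⟨fun a a' => by simp [withLabels, h₁, h.1 a a'], fun b b' => by simp [withLabels, h₂, h.2 b b']⟩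

theorem avgLength₁_withLabels [Fintype A] [Fintype B] (P : PMF (A × B)) :
    (Φ.withLabels h₁ h₂ T).avgLength₁ P = Φ.avgLength₁ P + m₁ := by
  simp only [avgLength₁, withLabels, List.length_append, h₁, Nat.cast_add, mul_add,
    Finset.sum_add_distrib, ← Finset.sum_mul, sum_toReal_eq_one, one_mul]

theorem avgLength₂_withLabels [Fintype A] [Fintype B] (P : PMF (A × B)) :
    (Φ.withLabels h₁ h₂ T).avgLength₂ P = Φ.avgLength₂ P + m₂ := by
  simp only [avgLength₂, withLabels, List.length_append, h₂, Nat.cast_add, mul_add,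
    Finset.sum_add_distrib, ← Finset.sum_mul]
  rw [Finset.sum_comm (f := fun (b : B) (a : A) => (P (a, b)).toReal), sum_toReal_eq_one, one_mul]

end Code

/-! ### Construction at one block length -/

/-- If `f x y = f x' y` cannot be told apart by the decoder, then wherever `x` and `x'` differ
one of the two pairs is exposed to a decoding error. -/
theorem hammingDist_le_card_exposed {X Y Z : Type*} [DecidableEq X] {n : ℕ}
    {f : (Fin n → X) → (Fin n → Y) → Z} (hf : SensitiveGivenSnd f)
    (Φ : Code (Fin n → X) (Fin n → Y) Z) {x x' : Fin n → X} {y : Fin n → Y}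
    (hxy : f x y = f x' y) (hc : Φ.enc₁ x = Φ.enc₁ x') :
    hammingDist x x' ≤ (exposed (fun x y => f x y ≠ Φ.output x y) x y).card +
      (exposed (fun x y => f x y ≠ Φ.output x y) x' y).card := by
  classical
  refine (Finset.card_le_card fun i hi => ?_).trans (Finset.card_union_le _ _)
  obtain ⟨y', -, hy', hne⟩ := hf x x' y i hxy (by simpa using hi)
  have hupd : Function.update y i (y' i) = y' := by
    ext j
    by_cases hj : j = i
    · subst hj; simp
    · simp [hj, hy' j hj]
  have hout : Φ.output x y' = Φ.output x' y' := by simp [Code.output, hc]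
  by_cases h : f x y' = Φ.output x y'
  · refine Finset.mem_union_right _ (Finset.mem_filter.2 ⟨Finset.mem_univ _, y' i, ?_⟩)
    rw [hupd]
    exact fun h' => hne (h.trans (hout.trans h'.symm))
  · refine Finset.mem_union_left _ (Finset.mem_filter.2 ⟨Finset.mem_univ _, y' i, ?_⟩)
    rwa [hupd]

/-- The code with the two terminals exchanged. -/
def Code.swap {A B Z : Type*} (Φ : Code A B Z) : Code B A Z :=
  ⟨Φ.enc₂, Φ.enc₁, fun c d => Φ.dec d c, Φ.prefix₂, Φ.prefix₁⟩

/-- One block length: a code for a totally sensitive function is turned into a Slepian–Wolf code by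
appending `m₁` and `m₂` bits to the codewords. -/
theorem exists_slepianWolf_code {X Y Z : Type*} [Fintype X] [DecidableEq X] [Fintype Y]
    [DecidableEq Y] {n : ℕ} (hn : 1 ≤ n) (P : PMF ((Fin n → X) × (Fin n → Y)))
    {f : (Fin n → X) → (Fin n → Y) → Z} (hf : TotallySensitive f)
    (Φ : Code (Fin n → X) (Fin n → Y) Z) {q₁ q₂ : ℝ} (hq₁ : 0 < q₁) (hq₁' : q₁ < 1) (hq₂ : 0 < q₂)
    (hq₂' : q₂ < 1)
    (hs₁ : ∀ (x x' : Fin n → X) (y : Fin n → Y), hammingDist x x' = 1 →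
      q₁ * (P (x, y)).toReal ≤ (P (x', y)).toReal)
    (hs₂ : ∀ (x : Fin n → X) (y y' : Fin n → Y), hammingDist y y' = 1 →
      q₂ * (P (x, y)).toReal ≤ (P (x, y')).toReal)
    {ρ : ℝ} (hρ : 0 < ρ) {m₁ m₂ : ℕ}
    (hm₁ : ∀ x : Fin n → X,
      (Finset.univ.filter fun x' => (hammingDist x x' : ℝ) ≤ ρ * n).card ≤ 2 ^ m₁)
    (hm₂ : ∀ y : Fin n → Y,
      (Finset.univ.filter fun y' => (hammingDist y y' : ℝ) ≤ ρ * n).card ≤ 2 ^ m₂) :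
    ∃ Ψ : Code (Fin n → X) (Fin n → Y) ((Fin n → X) × (Fin n → Y)),
      (Φ.IsFixedLength → Ψ.IsFixedLength) ∧
      Ψ.avgLength₁ P = Φ.avgLength₁ P + m₁ ∧
      Ψ.avgLength₂ P = Φ.avgLength₂ P + m₂ ∧
      Ψ.errorProb P (idFun X Y n) ≤
        (1 + (Fintype.card Y / (q₂ * (ρ / 2)) + Fintype.card X / (q₁ * (ρ / 2)))) *
          Φ.errorProb P f := by
  classical
  have : Nonempty ((Fin n → X) × (Fin n → Y)) := P.support_nonempty.to_type
  obtain ⟨b₁, hb₁, hsep₁⟩ := exists_bits_separating hρ.le hm₁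
  obtain ⟨b₂, hb₂, hsep₂⟩ := exists_bits_separating hρ.le hm₂
  set E : (Fin n → X) → (Fin n → Y) → Prop := fun x y => f x y ≠ Φ.output x y with hE
  set F : (Fin n → Y) → (Fin n → X) → Prop := fun y x => E x y with hF
  -- The good pairs. The threshold is `ρ / 2` because two pairs contribute to the distance bound.
  let T : (Fin n → X) → (Fin n → Y) → Prop := fun x y =>
    ¬ E x y ∧ ((exposed E x y).card : ℝ) ≤ ρ / 2 * n ∧ ((exposed F y x).card : ℝ) ≤ ρ / 2 * n
  have huniq : ∀ x y x' y', T x y → T x' y' → Φ.enc₁ x = Φ.enc₁ x' → Φ.enc₂ y = Φ.enc₂ y' →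
      b₁ x = b₁ x' → b₂ y = b₂ y' → x = x' ∧ y = y' := by
    rintro x y x' y' ⟨hg, hy, hx⟩ ⟨hg', hy', hx'⟩ h₁ h₂ hc₁ hc₂
    have hff : f x y = f x' y' := by
      rw [not_not.1 hg, not_not.1 hg']
      simp [Code.output, h₁, h₂]
    by_cases hyy : y = y'
    · subst hyy
      refine ⟨hsep₁ x x' ?_ hc₁, rfl⟩
      have : (hammingDist x x' : ℝ) ≤ (exposed E x y).card + (exposed E x' y).card := by
        exact_mod_cast hammingDist_le_card_exposed hf.2.2 Φ hff h₁
      linarith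
    · by_cases hxx : x = x'
      · subst hxx
        refine ⟨rfl, hsep₂ y y' ?_ hc₂⟩
        have : (hammingDist y y' : ℝ) ≤ (exposed F y x).card + (exposed F y' x).card := by
          exact_mod_cast hammingDist_le_card_exposed (f := fun y x => f x y)
            (fun y y' x i h hi => hf.2.1 x y y' i h hi) Φ.swap hff h₂
        linarith
      · exact absurd hff (hf.1 x x' y y' hxx hyy)
  refine ⟨Φ.withLabels hb₁ hb₂ T, Φ.isFixedLength_withLabels hb₁ hb₂ T, Φ.avgLength₁_withLabels hb₁ hb₂ T P,
    Φ.avgLength₂_withLabels hb₁ hb₂ T P, ?_⟩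
  have herr : Φ.errorProb P f = ∑ x, ∑ y, if E x y then (P (x, y)).toReal else 0 := by
    unfold Code.errorProb
    congr!
  have hsum₂ := sum_exposed_le (fun x y => (P (x, y)).toReal) (fun _ _ => ENNReal.toReal_nonneg)
    hq₂ hq₂' hs₂ E (half_pos hρ) hn
  have hsum₁ : (∑ x, ∑ y, if ρ / 2 * n < (exposed F y x).card then (P (x, y)).toReal else 0) ≤
      Fintype.card X / (q₁ * (ρ / 2)) * ∑ x, ∑ y, if E x y then (P (x, y)).toReal else 0 := by
    have h := sum_exposed_le (fun y x => (P (x, y)).toReal) (fun _ _ => ENNReal.toReal_nonneg)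
      hq₁ hq₁' (fun y x x' h => hs₁ x x' y h) F (half_pos hρ) hn
    rw [Finset.sum_comm] at h
    refine h.trans (le_of_eq ?_)
    rw [Finset.sum_comm]
    congr!
  rw [add_mul, add_mul, one_mul, herr]
  -- Union bound: a pair outside `T` is an error of `Φ` or heavily exposed in one component.
  refine le_trans ?_ (add_le_add le_rfl (add_le_add (hsum₂.trans_eq (by congr!)) hsum₁))
  simp only [Code.errorProb, ← Finset.sum_add_distrib]
  refine Finset.sum_le_sum fun x _ => Finset.sum_le_sum fun y _ => ?_
  have hp : 0 ≤ (P (x, y)).toReal := ENNReal.toReal_nonneg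
  by_cases hT : T x y
  · rw [Code.output_withLabels Φ hb₁ hb₂ T huniq hT, if_neg (by simp [idFun])]
    split_ifs <;> positivity
  · have : E x y ∨ ρ / 2 * n < (exposed E x y).card ∨ ρ / 2 * n < (exposed F y x).card := by
      by_contra! h
      exact hT ⟨h.1, h.2.1, h.2.2⟩
    refine le_trans (b := (P (x, y)).toReal) (by split_ifs <;> linarith) ?_
    rcases this with h | h | h <;> rw [if_pos h] <;> split_ifs <;> linarith

/-! ### Asymptotics -/

theorem Code.errorProb_nonneg {A B Z : Type*} [Fintype A] [Fintype B] (Φ : Code A B Z)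
    (P : PMF (A × B)) (f : A → B → Z) : 0 ≤ Φ.errorProb P f :=
  Finset.sum_nonneg fun _ _ => Finset.sum_nonneg fun _ _ => by
    split_ifs
    exacts [ENNReal.toReal_nonneg, le_rfl]

/-- The number of label bits used for words of length `n` at relative radius `ρ`. -/
noncomputable def labelBits (k n : ℕ) (ρ : ℝ) : ℕ :=
  ⌈n * (Real.negMulLog ρ + k * ρ) / Real.log 2⌉₊

theorem card_hammingBall_le_two_pow {X : Type*} [Fintype X] [DecidableEq X] {n : ℕ}
    (x : Fin n → X) {ρ : ℝ} (h0 : 0 < ρ) (h1 : ρ ≤ 1) :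
    (Finset.univ.filter fun x' => (hammingDist x x' : ℝ) ≤ ρ * n).card ≤
      2 ^ labelBits (Fintype.card X) n ρ := by
  have hlog : 0 < Real.log 2 := Real.log_pos one_lt_two
  have h := (card_hammingBall_le x h0 h1).trans (b := Real.exp _)
    (c := Real.exp (labelBits (Fintype.card X) n ρ * Real.log 2)) (Real.exp_le_exp.2
      ((div_le_iff₀ hlog).1 (Nat.le_ceil _)))
  rw [Real.exp_nat_mul, Real.exp_log two_pos] at h
  exact_mod_cast h

/-- The exponent vanishes with `ρ` by continuity of `negMulLog` at 0, and rounding up costs at most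
`1 / n`. -/
theorem tendsto_labelBits_div (k : ℕ) {ρ : ℕ → ℝ} (h0 : ∀ n, 0 < ρ n) (h1 : ∀ n, ρ n ≤ 1)
    (hρ : Tendsto ρ atTop (𝓝 0)) :
    Tendsto (fun n : ℕ => 1 / (n : ℝ) * (labelBits k n (ρ n) : ℝ)) atTop (𝓝 0) := by
  have hlog : 0 < Real.log 2 := Real.log_pos one_lt_two
  have hlim : Tendsto (fun n : ℕ => (Real.negMulLog (ρ n) + k * ρ n) / Real.log 2 + 1 / (n : ℝ))
      atTop (𝓝 0) := by
    have h := ((((Real.continuous_negMulLog.tendsto 0).comp hρ).add (hρ.const_mul (k : ℝ))).div_const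
      (Real.log 2)).add tendsto_one_div_atTop_nhds_zero_nat
    simpa using h
  refine tendsto_of_tendsto_of_tendsto_of_le_of_le' tendsto_const_nhds hlim
    (Eventually.of_forall fun n => by positivity) ?_
  filter_upwards [eventually_ge_atTop 1] with n hn
  have hn' : (0 : ℝ) < n := by exact_mod_cast hn
  have hnn : 0 ≤ n * (Real.negMulLog (ρ n) + k * ρ n) / Real.log 2 := by
    have := Real.negMulLog_nonneg (h0 n).le (h1 n)
    have := (h0 n).le
    positivity
  have h := (Nat.ceil_lt_add_one hnn).le
  calc 1 / (n : ℝ) * (labelBits k n (ρ n) : ℝ)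
      ≤ 1 / (n : ℝ) * (n * (Real.negMulLog (ρ n) + k * ρ n) / Real.log 2 + 1) :=
        mul_le_mul_of_nonneg_left h (by positivity)
    _ = _ := by field_simp

/-- Adding a vanishing term does not increase an upper limit. -/
theorem limsup_le_of_eventuallyEq_add {u v w : ℕ → ℝ} {R : ℝ}
    (hu : limsup (fun n => (u n : EReal)) atTop ≤ (R : EReal)) (hv : Tendsto v atTop (𝓝 0))
    (hw : ∀ᶠ n in atTop, w n = u n + v n) :
    limsup (fun n => (w n : EReal)) atTop ≤ (R : EReal) := by
  have hv' : limsup (fun n => (v n : EReal)) atTop = 0 := by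
    refine Tendsto.limsup_eq ?_
    exact_mod_cast (continuous_coe_real_ereal.tendsto 0).comp hv
  have hcongr : (fun n => (w n : EReal)) =ᶠ[atTop]
      (fun n => (u n : EReal)) + fun n => (v n : EReal) := by
    filter_upwards [hw] with n hn
    simp [hn]
  rw [limsup_congr hcongr]
  refine (EReal.limsup_add_le (by simp [hv']) (by simp [hv'])).trans ?_
  rw [hv', add_zero]
  exact hu

/-- Slepian–Wolf codes built blockwise from codes for a totally sensitive function achieve the same
rates. -/
theorem exists_slepianWolf_achieves {X Y : Type*} [Fintype X] [DecidableEq X] [Fintype Y]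
    [DecidableEq Y] {Z : ℕ → Type*} (P : Source X Y) (f : ∀ n, (Fin n → X) → (Fin n → Y) → Z n)
    (hP : Smooth P) (hf : ∀ n, 1 ≤ n → TotallySensitive (f n))
    (Φ : ∀ n, Code (Fin n → X) (Fin n → Y) (Z n)) (R₁ R₂ : ℝ) (hΦ : Achieves P f Φ R₁ R₂) :
    ∃ Ψ : ∀ n, Code (Fin n → X) (Fin n → Y) ((Fin n → X) × (Fin n → Y)),
      (∀ n, 1 ≤ n → (Φ n).IsFixedLength → (Ψ n).IsFixedLength) ∧
        Achieves P (idFun X Y) Ψ R₁ R₂ := by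
  obtain ⟨⟨q₁, hq₁, hq₁', hs₁⟩, q₂, hq₂, hq₂', hs₂⟩ := hP
  obtain ⟨herr, hR₁, hR₂⟩ := hΦ
  set ε : ℕ → ℝ := fun n => (Φ n).errorProb (P n) (f n) with hε
  have hε0 : ∀ n, 0 ≤ ε n := fun n => Code.errorProb_nonneg _ _ _
  -- The square root makes both `ρ` and `ε / ρ` vanish; the second term keeps `ρ` positive when `ε n
  -- = 0`.
  let s : ℕ → ℝ := fun n => √(ε n) + 1 / ((n : ℝ) + 1)
  have hs0 : ∀ n, 0 < s n := fun n => by positivity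
  have hsqrt : Tendsto (fun n => √(ε n)) atTop (𝓝 0) := by
    simpa [Function.comp_def] using (Real.continuous_sqrt.tendsto 0).comp herr
  have hs : Tendsto s atTop (𝓝 0) := by
    simpa [s] using hsqrt.add tendsto_one_div_add_atTop_nhds_zero_nat
  let ρ : ℕ → ℝ := fun n => min 1 (s n)
  have hρ0 : ∀ n, 0 < ρ n := fun n => lt_min one_pos (hs0 n)
  have hρ1 : ∀ n, ρ n ≤ 1 := fun n => min_le_left _ _
  have hρ : Tendsto ρ atTop (𝓝 0) := by
    simpa using (tendsto_const_nhds (x := (1 : ℝ))).min hs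
  have hquot : ∀ n, ε n / ρ n ≤ ε n + √(ε n) := by
    intro n
    have hsq : √(ε n) * √(ε n) = ε n := Real.mul_self_sqrt (hε0 n)
    rw [div_le_iff₀ (hρ0 n)]
    rcases min_choice 1 (s n) with h | h
    · simp only [ρ, h]
      nlinarith [Real.sqrt_nonneg (ε n)]
    · simp only [ρ, h]
      have h1 : √(ε n) ≤ s n := le_add_of_nonneg_right (by positivity)
      nlinarith [mul_le_mul_of_nonneg_left h1 (Real.sqrt_nonneg (ε n)),
        mul_nonneg (hε0 n) (hs0 n).le]
  have hblock : ∀ n, ∃ Ψ : Code (Fin n → X) (Fin n → Y) ((Fin n → X) × (Fin n → Y)), 1 ≤ n →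
      ((Φ n).IsFixedLength → Ψ.IsFixedLength) ∧
      Ψ.avgLength₁ (P n) = (Φ n).avgLength₁ (P n) + labelBits (Fintype.card X) n (ρ n) ∧
      Ψ.avgLength₂ (P n) = (Φ n).avgLength₂ (P n) + labelBits (Fintype.card Y) n (ρ n) ∧
      Ψ.errorProb (P n) (idFun X Y n) ≤
        (1 + (Fintype.card Y / (q₂ * (ρ n / 2)) + Fintype.card X / (q₁ * (ρ n / 2)))) * ε n := by
    intro n
    -- Nothing is required at length 0, so any code serves there.
    rcases Nat.eq_zero_or_pos n with rfl | hn
    · have : Nonempty ((Fin 0 → X) × (Fin 0 → Y)) := ⟨(Fin.elim0, Fin.elim0)⟩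
      exact ⟨(Φ 0).withLabels (b₁ := fun _ => []) (b₂ := fun _ => []) (fun _ => rfl) (fun _ => rfl)
        (fun _ _ => True), fun h => absurd h (by norm_num)⟩
    · obtain ⟨Ψ, hΨ⟩ := exists_slepianWolf_code hn (P n) (hf n hn) (Φ n) hq₁ hq₁' hq₂ hq₂'
        (hs₁ n hn) (hs₂ n hn) (hρ0 n) (fun x => card_hammingBall_le_two_pow x (hρ0 n) (hρ1 n))
        (fun y => card_hammingBall_le_two_pow y (hρ0 n) (hρ1 n))
      exact ⟨Ψ, fun _ => hΨ⟩
  choose Ψ hΨ using hblock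
  refine ⟨Ψ, fun n hn => (hΨ n hn).1, ?_, ?_, ?_⟩
  · set K : ℝ := 2 * Fintype.card Y / q₂ + 2 * Fintype.card X / q₁ with hK
    have hlim : Tendsto (fun n => ε n + K * (ε n + √(ε n))) atTop (𝓝 0) := by
      simpa using herr.add ((herr.add hsqrt).const_mul K)
    refine tendsto_of_tendsto_of_tendsto_of_le_of_le' tendsto_const_nhds hlim
      (Eventually.of_forall fun n => Code.errorProb_nonneg _ _ _) ?_
    filter_upwards [eventually_ge_atTop 1] with n hn
    refine (hΨ n hn).2.2.2.trans ?_
    have hK0 : 0 ≤ K := by positivity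
    have := mul_le_mul_of_nonneg_left (hquot n) hK0
    refine le_trans (le_of_eq ?_) (add_le_add le_rfl this)
    have := (hρ0 n).ne'
    rw [hK]
    field_simp
  · refine limsup_le_of_eventuallyEq_add hR₁
      (tendsto_labelBits_div (Fintype.card X) hρ0 hρ1 hρ) ?_
    filter_upwards [eventually_ge_atTop 1] with n hn
    rw [(hΨ n hn).2.1, mul_add]
  · refine limsup_le_of_eventuallyEq_add hR₂
      (tendsto_labelBits_div (Fintype.card Y) hρ0 hρ1 hρ) ?_
    filter_upwards [eventually_ge_atTop 1] with n hn
    rw [(hΨ n hn).2.2.1, mul_add]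

end FunctionCoding

theorem mainTheorem2 {X Y : Type*} [Fintype X] [DecidableEq X] [Fintype Y] [DecidableEq Y]
    {Z : ℕ → Type*} (P : FunctionCoding.Source X Y)
    (f : ∀ n, (Fin n → X) → (Fin n → Y) → Z n)
    (hP : FunctionCoding.Smooth P)
    (hf : ∀ n, 1 ≤ n → FunctionCoding.TotallySensitive (f n)) :
    (∀ (Φ : ∀ n, FunctionCoding.Code (Fin n → X) (Fin n → Y) (Z n)) (R₁ R₂ : ℝ),
      FunctionCoding.Achieves P f Φ R₁ R₂ →
      ∃ Ψ : ∀ n, FunctionCoding.Code (Fin n → X) (Fin n → Y) ((Fin n → X) × (Fin n → Y)),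
        FunctionCoding.Achieves P (FunctionCoding.idFun X Y) Ψ R₁ R₂) ∧
    (∀ (Φ : ∀ n, FunctionCoding.Code (Fin n → X) (Fin n → Y) (Z n)) (R₁ R₂ : ℝ),
      (∀ n, 1 ≤ n → (Φ n).IsFixedLength) →
      FunctionCoding.Achieves P f Φ R₁ R₂ →
      ∃ Ψ : ∀ n, FunctionCoding.Code (Fin n → X) (Fin n → Y) ((Fin n → X) × (Fin n → Y)),
        (∀ n, 1 ≤ n → (Ψ n).IsFixedLength) ∧
        FunctionCoding.Achieves P (FunctionCoding.idFun X Y) Ψ R₁ R₂) := by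
  refine ⟨fun Φ R₁ R₂ h => ?_, fun Φ R₁ R₂ hfix h => ?_⟩
  · obtain ⟨Ψ, -, hΨ⟩ := FunctionCoding.exists_slepianWolf_achieves P f hP hf Φ R₁ R₂ h
    exact ⟨Ψ, hΨ⟩
  · obtain ⟨Ψ, hΨ', hΨ⟩ := FunctionCoding.exists_slepianWolf_achieves P f hP hf Φ R₁ R₂ h
    exact ⟨Ψ, fun n hn => hΨ' n hn (hfix n hn), hΨ⟩
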